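/- For a positive integer $n$ let $[n]^2=\{1,\dots,n\}^2$ with the coordinatewise order, and let $\mathrm{TARSKI}(n,2)$ be the problem of finding a point $x$ with $f(x)=x$, given query access to an unknown monotone function $f:[n]^2\to[n]^2$. Fix any representation of the points of $[n]^2$ by distinct bit strings of a common length $\ell$. A $T$-query quantum algorithm works on the space spanned by the basis states $|i,a,z\rangle$, where $i\in[n]^2$, $a\in\{0,1\}^{\ell}$ and $z$ ranges over a finite set; it starts in a fixed unit vector and applies $U_T\,\mathcal O_f\,U_{T-1}\cdots\mathcal O_f\,U_0$, where $U_0,\dots,U_T$ are unitary operators that do not depend on $f$ and the query operator is $\mathcal O_f|i,a,z\rangle=|i,a\oplus f(i),z\rangle$, with $\oplus$ the bitwise exclusive or. The final state is measured in this basis, and the output is a fixed function, with values in $[n]^2$, of the outcome. The bounded-error quantum query complexity $Q(\mathrm{TARSKI}(n,2))$ is the least $T$ for which some $T$-query algorithm outputs, for every monotone $f$, a fixed point of $f$ with probability at least $2/3$. Theorem. $Q(\mathrm{TARSKI}(n,2))=\Omega((\log n)^2)$: there are constants $c>0$ and $N$ such that for all $n\ge N$, whatever the representation by bit strings, $Q(\mathrm{TARSKI}(n,2))\ge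 c\,(\log n)^2$. -/

import Mathlib

open scoped ENNReal

namespace QuantumQuery

/-- Bit strings of length `ℓ`. -/
abbrev BitString (ℓ : ℕ) : Type := Fin ℓ → Bool

/-- Labels `(i, a, z)` of the computational basis: `i` is a query index, `a` is the content of the
`ℓ`-bit answer register, and `z` is the content of a workspace register of finite dimension `w`. -/
abbrev BasisLabel (ι : Type) (ℓ w : ℕ) : Type := ι × BitString ℓ × Fin w

/-- Vectors of amplitudes `α i a z`, with the `ℓ²` inner product. -/
abbrev StateSpace (ι : Type) (ℓ w : ℕ) : Type := EuclideanSpace ℂ (BasisLabel ι ℓ w)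

/-- The permutation `(i, a, z) ↦ (i, a ⊕ s i, z)` of the basis labels, where the character `s i` is
written in binary by means of `enc` and `⊕` is the bitwise exclusive or. -/
def queryPerm {ι G : Type} {ℓ : ℕ} (w : ℕ) (enc : G ↪ BitString ℓ) (s : ι → G) :
    Equiv.Perm (BasisLabel ι ℓ w) where
  toFun b := (b.1, fun j => xor (b.2.1 j) (enc (s b.1) j), b.2.2)
  invFun b := (b.1, fun j => xor (b.2.1 j) (enc (s b.1) j), b.2.2)
  left_inv b := by simp
  right_inv b := by simp

/-- The oracle gate: the unitary operator with `|i, a, z⟩ ↦ |i, a ⊕ s i, z⟩`. -/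
noncomputable def oracleGate {ι G : Type} [Fintype ι] {ℓ : ℕ} (w : ℕ)
    (enc : G ↪ BitString ℓ) (s : ι → G) : StateSpace ι ℓ w ≃ₗᵢ[ℂ] StateSpace ι ℓ w :=
  LinearIsometryEquiv.piLpCongrLeft 2 ℂ ℂ (queryPerm w enc s)

/-- A quantum query algorithm for inputs indexed by `ι`, with an answer register of `ℓ` bits and
with outputs in `O`. It consists of a number of queries, a workspace dimension, an initial
state, unitary operators `U 0, …, U queries` (later ones are never used) and the rule that reads the
output off the outcome of the final measurement in the computational basis. None of these data
depends on the input. -/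
structure Algorithm (ι O : Type) [Fintype ι] (ℓ : ℕ) where
  queries : ℕ
  workDim : ℕ
  init : StateSpace ι ℓ workDim
  norm_init : ‖init‖ = 1
  U : ℕ → (StateSpace ι ℓ workDim ≃ₗᵢ[ℂ] StateSpace ι ℓ workDim)
  output : BasisLabel ι ℓ workDim → O

/-- The state `U t · O_s · U (t - 1) · ⋯ · O_s · U 0 · init`, which is reached on input `s`
after `t` queries. -/
noncomputable def Algorithm.stateAfter {ι G O : Type} [Fintype ι] {ℓ : ℕ}
    (A : Algorithm ι O ℓ) (enc : G ↪ BitString ℓ) (s : ι → G) :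
    ℕ → StateSpace ι ℓ A.workDim
  | 0 => A.U 0 A.init
  | t + 1 => A.U (t + 1) (oracleGate A.workDim enc s (A.stateAfter enc s t))

open Classical in
/-- The probability that the output of the algorithm on input `s` satisfies `P`. -/
noncomputable def Algorithm.prob {ι G O : Type} [Fintype ι] {ℓ : ℕ}
    (A : Algorithm ι O ℓ) (enc : G ↪ BitString ℓ) (s : ι → G) (P : O → Prop) : ℝ :=
  ∑ b : BasisLabel ι ℓ A.workDim with P (A.output b), ‖A.stateAfter enc s A.queries b‖ ^ 2

/-- A query problem: the set of admissible inputs, and for every input the set of correct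
answers. -/
structure Problem (ι G O : Type) where
  domain : Set (ι → G)
  correct : (ι → G) → O → Prop

/-- The algorithm succeeds on every admissible input: its output is correct with probability at
least `2 / 3`. -/
def Algorithm.Solves {ι G O : Type} [Fintype ι] {ℓ : ℕ}
    (A : Algorithm ι O ℓ) (enc : G ↪ BitString ℓ) (p : Problem ι G O) : Prop :=
  ∀ s ∈ p.domain, 2 / 3 ≤ A.prob enc s (p.correct s)

/-- The bounded-error quantum query complexity: the minimum number of queries of an algorithm that
succeeds on every admissible input (`⊤` if there is none). -/
noncomputable def queryComplexity {ι G O : Type} [Fintype ι] {ℓ : ℕ}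
    (enc : G ↪ BitString ℓ) (p : Problem ι G O) : ℕ∞ :=
  ⨅ (A : Algorithm ι O ℓ) (_ : A.Solves enc p), (A.queries : ℕ∞)

/-- The grid `[n]^k`; as a type of functions it carries the coordinatewise order. -/
abbrev Grid (n k : ℕ) : Type := Fin k → Fin n

/-- `TARSKI(n, k)`: given query access to a monotone function on the grid, find a fixed point. -/
def tarski (n k : ℕ) : Problem (Grid n k) (Grid n k) (Grid n k) where
  domain := {f | Monotone f}
  correct f x := f x = x

end QuantumQuery

namespace QuantumQuery

/-! The hard inputs nest one ordered search inside another. On an ascending staircase the motion is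
forward up to segment `j` and backward afterwards, so a fixed point must lie in blocks with `x / m +
y / m = j`: finding it amounts to an ordered search for `j` among `m ≈ √n` segments. Each segment is
displaced by a hidden offset inside a block of width `m`, and its direction shows only at the exact
offset, so in effect each comparison with `j` costs an ordered search for an offset. A query merely
compares one vertical and one horizontal offset with given values.

The bound follows from the nonnegative adversary method (`adversary_bound`). For ordered search the
matrix is `1 / (i ⊕ j)`: its row sums are of order `log m`, while the pairs separated by one cut
form a Hilbert-type matrix of norm `O(1)` (`sum_xorKernel_cut_le`). The matrix `adversary` takes
this kernel in `j` and the normalised kernel in every offset whose direction changes. Its row sums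
are still of order `log m`, but the pairs that one query tells apart have norm `O(1 / log m)`
(`distinguished_quadratic_le`). The quotient is of order `(log m)²`. -/

/-! ### The adversary bound for quantum queries. -/

/-- The real part of the inner product of the components of `u` and `v` with query index `q`. -/
noncomputable def overlap {ι : Type} {ℓ w : ℕ} (q : ι) (u v : StateSpace ι ℓ w) : ℝ :=
  ∑ c : BitString ℓ × Fin w, (inner ℂ (u (q, c)) (v (q, c))).re

/-- The squared norm of the component of `u` with query index `q`. -/
noncomputable def mass {ι : Type} {ℓ w : ℕ} (q : ι) (u : StateSpace ι ℓ w) : ℝ :=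
  ∑ c : BitString ℓ × Fin w, ‖u (q, c)‖ ^ 2

theorem mass_nonneg {ι : Type} {ℓ w : ℕ} (q : ι) (u : StateSpace ι ℓ w) : 0 ≤ mass q u :=
  Finset.sum_nonneg fun _ _ => by positivity

theorem re_inner_eq_sum_overlap {ι : Type} [Fintype ι] {ℓ w : ℕ} (u v : StateSpace ι ℓ w) :
    (inner ℂ u v).re = ∑ q, overlap q u v := by
  rw [PiLp.inner_apply, Complex.re_sum, Fintype.sum_prod_type]
  rfl

theorem sum_mass {ι : Type} [Fintype ι] {ℓ w : ℕ} (u : StateSpace ι ℓ w) :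
    ∑ q, mass q u = ‖u‖ ^ 2 := by
  rw [EuclideanSpace.norm_sq_eq, Fintype.sum_prod_type]
  rfl

theorem abs_overlap_le {ι : Type} {ℓ w : ℕ} (q : ι) (u v : StateSpace ι ℓ w) :
    |overlap q u v| ≤ √(mass q u) * √(mass q v) := by
  calc |overlap q u v| ≤ ∑ c : BitString ℓ × Fin w, ‖u (q, c)‖ * ‖v (q, c)‖ := by
        refine (Finset.abs_sum_le_sum_abs _ _).trans (Finset.sum_le_sum fun c _ => ?_)
        exact (Complex.abs_re_le_norm _).trans (norm_inner_le_norm _ _)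
    _ ≤ _ := Real.sum_mul_le_sqrt_mul_sqrt _ _ _

theorem oracleGate_apply {ι G : Type} [Fintype ι] {ℓ w : ℕ} (enc : G ↪ BitString ℓ) (s : ι → G)
    (u : StateSpace ι ℓ w) (b : BasisLabel ι ℓ w) :
    oracleGate w enc s u b = u (queryPerm w enc s b) := by
  rfl

/-- The action of a query with answer `g` on the answer register and the workspace. -/
def answerPerm {G : Type} {ℓ : ℕ} (w : ℕ) (enc : G ↪ BitString ℓ) (g : G) :
    Equiv.Perm (BitString ℓ × Fin w) where
  toFun c := (fun j => xor (c.1 j) (enc g j), c.2)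
  invFun c := (fun j => xor (c.1 j) (enc g j), c.2)
  left_inv c := by simp
  right_inv c := by simp

theorem mass_oracleGate {ι G : Type} [Fintype ι] {ℓ w : ℕ} (enc : G ↪ BitString ℓ) (s : ι → G)
    (q : ι) (u : StateSpace ι ℓ w) : mass q (oracleGate w enc s u) = mass q u :=
  Equiv.sum_comp (answerPerm w enc (s q)) fun c => ‖u (q, c)‖ ^ 2

theorem overlap_oracleGate {ι G : Type} [Fintype ι] {ℓ w : ℕ} (enc : G ↪ BitString ℓ)
    (s t : ι → G) (q : ι) (h : s q = t q) (u v : StateSpace ι ℓ w) :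
    overlap q (oracleGate w enc s u) (oracleGate w enc t v) = overlap q u v := by
  have key := Equiv.sum_comp (answerPerm w enc (s q))
    fun c => (inner ℂ (u (q, c)) (v (q, c))).re
  rw [overlap, overlap, ← key]
  refine Finset.sum_congr rfl fun c _ => ?_
  rw [oracleGate_apply, oracleGate_apply]
  simp only [queryPerm, answerPerm, Equiv.coe_fn_mk, h]

theorem Algorithm.norm_stateAfter {ι G O : Type} [Fintype ι] {ℓ : ℕ} (A : Algorithm ι O ℓ)
    (enc : G ↪ BitString ℓ) (s : ι → G) (t : ℕ) : ‖A.stateAfter enc s t‖ = 1 := by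
  induction t with
  | zero => simp [stateAfter, A.norm_init]
  | succ t ih => simp [stateAfter, ih]

/-- States which are concentrated on disjoint sets of labels have a small inner product. -/
theorem re_inner_le_of_disjoint {κ : Type} [Fintype κ] (u v : EuclideanSpace ℂ κ)
    (hu : ‖u‖ = 1) (hv : ‖v‖ = 1) (S R : Finset κ) (hSR : Disjoint S R)
    (hS : 2 / 3 ≤ ∑ b ∈ S, ‖u b‖ ^ 2) (hR : 2 / 3 ≤ ∑ b ∈ R, ‖v b‖ ^ 2) :
    (inner ℂ u v).re ≤ 17 / 18 := by
  classical
  have hu' : ∑ b ∈ S, ‖u b‖ ^ 2 + ∑ b ∈ Sᶜ, ‖u b‖ ^ 2 = 1 := by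
    rw [Finset.sum_add_sum_compl, ← EuclideanSpace.norm_sq_eq, hu, one_pow]
  have hv' : ∑ b ∈ S, ‖v b‖ ^ 2 + ∑ b ∈ Sᶜ, ‖v b‖ ^ 2 = 1 := by
    rw [Finset.sum_add_sum_compl, ← EuclideanSpace.norm_sq_eq, hv, one_pow]
  have hRS : ∑ b ∈ R, ‖v b‖ ^ 2 ≤ ∑ b ∈ Sᶜ, ‖v b‖ ^ 2 :=
    Finset.sum_le_sum_of_subset_of_nonneg
      (fun b hb => Finset.mem_compl.2 fun hb' => Finset.disjoint_left.1 hSR hb' hb)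
      fun _ _ _ => by positivity
  have term (b : κ) : (inner ℂ (u b) (v b)).re ≤ ‖u b‖ * ‖v b‖ :=
    (Complex.re_le_norm _).trans (norm_inner_le_norm _ _)
  -- AM-GM, as `4 · (3/8) · (2/3) = 1`. The larger weight goes to the vector with mass at most `1/3`
  -- on the set, so the total is at most `2 (3/8 · 2/3 + 2/3 · 1/3) = 17/18`.
  have h1 : ∑ b ∈ S, (inner ℂ (u b) (v b)).re ≤
      3 / 8 * ∑ b ∈ S, ‖u b‖ ^ 2 + 2 / 3 * ∑ b ∈ S, ‖v b‖ ^ 2 := by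
    rw [Finset.mul_sum, Finset.mul_sum, ← Finset.sum_add_distrib]
    refine Finset.sum_le_sum fun b _ => (term b).trans ?_
    nlinarith [sq_nonneg (3 * ‖u b‖ - 4 * ‖v b‖)]
  have h2 : ∑ b ∈ Sᶜ, (inner ℂ (u b) (v b)).re ≤
      2 / 3 * ∑ b ∈ Sᶜ, ‖u b‖ ^ 2 + 3 / 8 * ∑ b ∈ Sᶜ, ‖v b‖ ^ 2 := by
    rw [Finset.mul_sum, Finset.mul_sum, ← Finset.sum_add_distrib]
    refine Finset.sum_le_sum fun b _ => (term b).trans ?_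
    nlinarith [sq_nonneg (4 * ‖u b‖ - 3 * ‖v b‖)]
  rw [PiLp.inner_apply, Complex.re_sum, ← Finset.sum_add_sum_compl S]
  linarith

/-- One query changes the weighted sum of the inner products by a bounded amount. -/
theorem weighted_overlap_sub_le {X ι G : Type} [Fintype X] [Fintype ι] {ℓ w : ℕ}
    (enc : G ↪ BitString ℓ) (F : X → ι → G) (Γ : X → X → ℝ) (μ : ℝ)
    (hΓ : ∀ x y, 0 ≤ Γ x y)
    (hμ : ∀ (q : ι) (u : X → ℝ), ∑ x, ∑ y, (open Classical in if F x q = F y q then 0 else Γ x y) *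
      (u x * u y) ≤ μ * ∑ x, u x ^ 2)
    (ψ : X → StateSpace ι ℓ w) (hψ : ∀ x, ‖ψ x‖ = 1) :
    ∑ x, ∑ y, Γ x y * (inner ℂ (ψ x) (ψ y)).re -
      ∑ x, ∑ y, Γ x y *
        (inner ℂ (oracleGate w enc (F x) (ψ x)) (oracleGate w enc (F y) (ψ y))).re ≤
      2 * μ * Fintype.card X := by
  classical
  have term (q : ι) (x y : X) :
      Γ x y * (overlap q (ψ x) (ψ y) -
        overlap q (oracleGate w enc (F x) (ψ x)) (oracleGate w enc (F y) (ψ y))) ≤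
      2 * ((if F x q = F y q then 0 else Γ x y) * (√(mass q (ψ x)) * √(mass q (ψ y)))) := by
    -- Only indices with different answers contribute. There the overlaps before and after the query
    -- obey the same bound, since a query preserves masses; hence the factor 2.
    split_ifs with h
    · rw [overlap_oracleGate enc _ _ q h]; simp
    · have h1 := abs_overlap_le q (ψ x) (ψ y)
      have h2 := abs_overlap_le q (oracleGate w enc (F x) (ψ x)) (oracleGate w enc (F y) (ψ y))
      rw [mass_oracleGate, mass_oracleGate] at h2
      have := mul_le_mul_of_nonneg_left (sub_le_iff_le_add.2 (show overlap q (ψ x) (ψ y) ≤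
        2 * (√(mass q (ψ x)) * √(mass q (ψ y))) +
        overlap q (oracleGate w enc (F x) (ψ x)) (oracleGate w enc (F y) (ψ y)) by
          linarith [abs_le.1 h1, abs_le.1 h2])) (hΓ x y)
      linarith
  calc _ = ∑ q, ∑ x, ∑ y, Γ x y * (overlap q (ψ x) (ψ y) -
        overlap q (oracleGate w enc (F x) (ψ x)) (oracleGate w enc (F y) (ψ y))) := by
        rw [← Finset.sum_sub_distrib]
        refine Eq.trans (Finset.sum_congr rfl fun x _ => ?_) Finset.sum_comm
        rw [← Finset.sum_sub_distrib]
        refine Eq.trans (Finset.sum_congr rfl fun y _ => ?_) Finset.sum_comm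
        rw [← Finset.mul_sum, Finset.sum_sub_distrib, re_inner_eq_sum_overlap,
          re_inner_eq_sum_overlap, mul_sub]
    _ ≤ ∑ q, ∑ x, ∑ y,
        2 * ((if F x q = F y q then 0 else Γ x y) * (√(mass q (ψ x)) * √(mass q (ψ y)))) :=
        Finset.sum_le_sum fun q _ => Finset.sum_le_sum fun x _ => Finset.sum_le_sum fun y _ =>
          term q x y
    _ ≤ ∑ q, 2 * (μ * ∑ x, mass q (ψ x)) := by
        refine Finset.sum_le_sum fun q _ => ?_
        simp only [← Finset.mul_sum]
        have := hμ q fun x => √(mass q (ψ x))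
        simp only [Real.sq_sqrt (mass_nonneg q _)] at this
        linarith
    _ = _ := by
        rw [← Finset.mul_sum, ← Finset.mul_sum, Finset.sum_comm]
        simp [sum_mass, hψ, mul_assoc]

/-- The adversary bound for quantum query algorithms, for a nonnegative adversary matrix with
constant row sums. -/
theorem Algorithm.Solves.adversary_bound {X ι G O : Type} [Fintype X] [Nonempty X] [Fintype ι]
    {ℓ : ℕ} {enc : G ↪ BitString ℓ} {A : Algorithm ι O ℓ} {p : Problem ι G O}
    (hA : A.Solves enc p) (F : X → ι → G) (hF : ∀ x, F x ∈ p.domain)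
    (Γ : X → X → ℝ) (r μ : ℝ) (hΓ : ∀ x y, 0 ≤ Γ x y) (hr : ∀ x, ∑ y, Γ x y = r)
    (hdisj : ∀ x y, Γ x y ≠ 0 → ∀ o, p.correct (F x) o → ¬ p.correct (F y) o)
    (hμ : ∀ (q : ι) (u : X → ℝ), ∑ x, ∑ y, (open Classical in if F x q = F y q then 0 else Γ x y) *
      (u x * u y) ≤ μ * ∑ x, u x ^ 2) :
    r ≤ 36 * μ * A.queries := by
  classical
  -- Before the first query the state does not depend on the input.
  have start : ∑ x, ∑ y, Γ x y * (inner ℂ (A.stateAfter enc (F x) 0)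
      (A.stateAfter enc (F y) 0)).re = r * Fintype.card X := by
    simp [stateAfter, A.norm_init, hr, mul_comm]
  have step (t : ℕ) : r * Fintype.card X - ∑ x, ∑ y, Γ x y * (inner ℂ (A.stateAfter enc (F x) t)
      (A.stateAfter enc (F y) t)).re ≤ 2 * μ * Fintype.card X * t := by
    induction t with
    | zero => rw [start]; simp
    | succ t ih =>
      have h := weighted_overlap_sub_le enc F Γ μ hΓ hμ (fun x => A.stateAfter enc (F x) t)
        fun x => A.norm_stateAfter enc (F x) t
      simp only [stateAfter, LinearIsometryEquiv.inner_map_map]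
      push_cast
      linarith
  have final : ∑ x, ∑ y, Γ x y * (inner ℂ (A.stateAfter enc (F x) A.queries)
      (A.stateAfter enc (F y) A.queries)).re ≤ 17 / 18 * (r * Fintype.card X) := by
    calc _ ≤ ∑ x, ∑ y, Γ x y * (17 / 18) := by
          refine Finset.sum_le_sum fun x _ => Finset.sum_le_sum fun y _ => ?_
          by_cases h : Γ x y = 0
          · simp [h]
          · refine mul_le_mul_of_nonneg_left ?_ (hΓ x y)
            refine re_inner_le_of_disjoint _ _ (A.norm_stateAfter _ _ _) (A.norm_stateAfter _ _ _)
              _ _ ?_ (hA _ (hF x)) (hA _ (hF y))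
            refine Finset.disjoint_left.2 fun b hb hb' => ?_
            exact hdisj x y h _ (Finset.mem_filter.1 hb).2 (Finset.mem_filter.1 hb').2
      _ = _ := by simp [← Finset.sum_mul, hr]; ring
  have hcard : (0 : ℝ) < Fintype.card X := by exact_mod_cast Fintype.card_pos
  refine le_of_mul_le_mul_right ?_ hcard
  -- The weighted sum must drop by `r / 18` per input and each query lowers it by at most `2 μ` per
  -- input: `36 = 2 · 18`.
  linarith [step A.queries]

end QuantumQuery

/-! ### The Schur test. -/

/-- The Schur test for the quadratic form of a nonnegative symmetric matrix. -/
theorem schur_test {X : Type*} [Fintype X] (M : X → X → ℝ) (w : X → ℝ) (μ : ℝ)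
    (hM : ∀ x y, 0 ≤ M x y) (hsymm : ∀ x y, M x y = M y x) (hw : ∀ x, 0 < w x)
    (h : ∀ x, ∑ y, M x y * w y ≤ μ * w x) (u : X → ℝ) :
    ∑ x, ∑ y, M x y * (u x * u y) ≤ μ * ∑ x, u x ^ 2 := by
  have row (x : X) : ∑ y, M x y * w y * (u x ^ 2 / w x) ≤ μ * u x ^ 2 := by
    rw [← Finset.sum_mul]
    calc _ ≤ μ * w x * (u x ^ 2 / w x) :=
          mul_le_mul_of_nonneg_right (h x) (div_nonneg (sq_nonneg _) (hw x).le)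
      _ = _ := by field_simp [(hw x).ne']
  have term (x y : X) : M x y * (u x * u y) ≤
      (M x y * w y * (u x ^ 2 / w x) + M y x * w x * (u y ^ 2 / w y)) / 2 := by
    have hx := hw x
    have hy := hw y
    have : u x * u y ≤ (w y * (u x ^ 2 / w x) + w x * (u y ^ 2 / w y)) / 2 := by
      have e : (w y * (u x ^ 2 / w x) + w x * (u y ^ 2 / w y)) / 2 - u x * u y =
          (w y * u x - w x * u y) ^ 2 / (2 * w x * w y) := by field_simp; ring
      have := div_nonneg (sq_nonneg (w y * u x - w x * u y)) (by positivity : 0 ≤ 2 * w x * w y)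
      linarith
    rw [hsymm y x]
    calc _ ≤ M x y * ((w y * (u x ^ 2 / w x) + w x * (u y ^ 2 / w y)) / 2) :=
          mul_le_mul_of_nonneg_left this (hM x y)
      _ = _ := by ring
  calc _ ≤ ∑ x, ∑ y, (M x y * w y * (u x ^ 2 / w x) + M y x * w x * (u y ^ 2 / w y)) / 2 :=
        Finset.sum_le_sum fun x _ => Finset.sum_le_sum fun y _ => term x y
    _ = ∑ x, ∑ y, M x y * w y * (u x ^ 2 / w x) := by
        simp only [← Finset.sum_div, Finset.sum_add_distrib]
        rw [Finset.sum_comm (f := fun x y => M y x * w x * (u y ^ 2 / w y))]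
        ring
    _ ≤ _ := by
        rw [Finset.mul_sum]
        exact Finset.sum_le_sum fun x _ => row x

namespace TarskiLowerBound

/-! ### The kernel `1 / (i ⊕ j)` and its restriction to a cut. -/

/-- Exclusive or is addition without carries; the induction strips the last binary digit. -/
theorem xor_le_add (a b : ℕ) : a ^^^ b ≤ a + b := by
  induction a using Nat.strong_induction_on generalizing b with
  | _ a ih =>
    rcases Nat.eq_zero_or_pos a with rfl | ha
    · simp
    · have h := ih (a / 2) (by omega) (b / 2)
      rw [← Nat.xor_div_two] at h
      have := @Nat.xor_mod_two_eq a b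
      omega

theorem le_add_xor (a b : ℕ) : a ≤ b + (a ^^^ b) := by
  have := xor_le_add b (a ^^^ b)
  rwa [Nat.xor_comm a b, ← Nat.xor_assoc, Nat.xor_self, Nat.zero_xor, Nat.xor_comm b a] at this

/-- The kernel `1 / (i ⊕ j)`, with value `0` on the diagonal. -/
noncomputable def xorKernel (i j : ℕ) : ℝ := ((i ^^^ j : ℕ) : ℝ)⁻¹

theorem xorKernel_nonneg (i j : ℕ) : 0 ≤ xorKernel i j := by unfold xorKernel; positivity

theorem xorKernel_comm (i j : ℕ) : xorKernel i j = xorKernel j i := by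
  rw [xorKernel, xorKernel, Nat.xor_comm]

theorem xorKernel_self (i : ℕ) : xorKernel i i = 0 := by simp [xorKernel]

/-- The row sum of the kernel on `{0, …, m - 1}` where `m` is a power of two. -/
noncomputable def rowSum (m : ℕ) : ℝ := ∑ t : Fin m, ((t : ℕ) : ℝ)⁻¹

/-- The map `j ↦ i ⊕ j` permutes `{0, …, 2 ^ k - 1}`. The kernel `1 / |i - j|` would not have
constant row sums. -/
theorem sum_xorKernel (k : ℕ) (i : Fin (2 ^ k)) :
    ∑ j : Fin (2 ^ k), xorKernel i j = rowSum (2 ^ k) := by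
  refine Finset.sum_nbij' (fun j => ⟨i ^^^ j, Nat.xor_lt_two_pow i.2 j.2⟩)
    (fun j => ⟨i ^^^ j, Nat.xor_lt_two_pow i.2 j.2⟩) (by simp) (by simp) ?_ ?_ ?_
  · intro j _; ext; simp
  · intro j _; ext; simp
  · intro j _; rfl

/-- The term `t = 0` is `0⁻¹ = 0`, so `rowSum m` is the harmonic number of `m - 1`. -/
theorem log_le_rowSum {m : ℕ} (hm : 0 < m) : Real.log m ≤ rowSum m := by
  obtain ⟨n, rfl⟩ := Nat.exists_eq_add_of_lt hm
  have := log_add_one_le_harmonic n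
  rw [zero_add, rowSum, Fin.sum_univ_eq_sum_range (fun t => ((t : ℕ) : ℝ)⁻¹),
    Finset.sum_range_succ']
  simpa [harmonic] using this

/-- The Schur estimate for the Hilbert matrix. -/
theorem sum_range_inv_mul_inv_sqrt_le (p R : ℕ) :
    ∑ r ∈ Finset.range R, ((p + r + 1 : ℕ) : ℝ)⁻¹ * (√(r + 1 : ℕ))⁻¹ ≤
      8 * (√(p + 1 : ℕ))⁻¹ := by
  set c := √(p + 1 : ℕ) with hc
  have hc0 : 0 < c := Real.sqrt_pos.2 (by positivity)
  have hc2 : c ^ 2 = p + 1 := by rw [hc, Real.sq_sqrt (by positivity)]; push_cast; ring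
  -- A bounded telescoping majorant, playing the role of an arctangent. In the induction step `8 = 4
  -- · 2`, from `(u + c)² ≤ 2 (u² + c²) ≤ 4 (p + r + 1)` and `u - v ≥ 1 / (2 u)`.
  have key : ∑ r ∈ Finset.range R, ((p + r + 1 : ℕ) : ℝ)⁻¹ * (√(r + 1 : ℕ))⁻¹ ≤
      8 * (c⁻¹ * (√R / (√R + c))) := by
    induction R with
    | zero => simp
    | succ r ih =>
      rw [Finset.sum_range_succ]
      have hu0 : 0 < √(r + 1 : ℕ) := Real.sqrt_pos.2 (by positivity)
      have hu2 : √(r + 1 : ℕ) ^ 2 = r + 1 := by rw [Real.sq_sqrt (by positivity)]; push_cast; ring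
      have hv0 : 0 ≤ √(r : ℝ) := Real.sqrt_nonneg _
      have hv2 : √(r : ℝ) ^ 2 = r := Real.sq_sqrt (by positivity)
      have huv : √(r : ℝ) ≤ √(r + 1 : ℕ) := Real.sqrt_le_sqrt (by push_cast; linarith)
      generalize √(r + 1 : ℕ) = u at *
      generalize √(r : ℝ) = v at *
      have hdiff : 8 * (c⁻¹ * (u / (u + c))) - 8 * (c⁻¹ * (v / (v + c))) =
          8 * (u - v) / ((u + c) * (v + c)) := by field_simp; ring
      have hterm : ((p + r + 1 : ℕ) : ℝ)⁻¹ * u⁻¹ ≤ 8 * (u - v) / ((u + c) * (v + c)) := by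
        rw [← mul_inv, inv_eq_one_div, div_le_div_iff₀ (by positivity) (by positivity)]
        have h1 : (u + c) * (v + c) ≤ 4 * (p + r + 1 : ℕ) := by
          push_cast
          nlinarith [sq_nonneg (u - c), mul_le_mul_of_nonneg_right huv (by positivity : 0 ≤ u + c)]
        have h2 : 1 ≤ 2 * u * (u - v) := by nlinarith
        have h3 : (0 : ℝ) < (p + r + 1 : ℕ) := by positivity
        nlinarith
      linarith
  refine key.trans (mul_le_mul_of_nonneg_left ?_ (by norm_num))
  refine mul_le_of_le_one_right (by positivity) ?_
  rw [div_le_one (by positivity)]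
  linarith

theorem sum_inv_mul_inv_sqrt_le (p : ℕ) (S : Finset ℕ) :
    ∑ r ∈ S, ((p + r + 1 : ℕ) : ℝ)⁻¹ * (√(r + 1 : ℕ))⁻¹ ≤ 8 * (√(p + 1 : ℕ))⁻¹ :=
  (Finset.sum_le_sum_of_subset_of_nonneg
    (fun r hr => Finset.mem_range.2 (Nat.lt_succ_of_le (Finset.le_sup (f := id) hr)))
    fun _ _ _ => by positivity).trans (sum_range_inv_mul_inv_sqrt_le p (S.sup id).succ)

/-- The distance of `i` from the cut between `e - 1` and `e`. -/
def cutDist (e i : ℕ) : ℕ := if i < e then e - 1 - i else i - e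

/-- The weights in the Schur test for the kernel restricted to pairs separated by a cut. -/
noncomputable def cutWeight (e i : ℕ) : ℝ := (√(cutDist e i + 1 : ℕ))⁻¹

theorem cutWeight_pos (e i : ℕ) : 0 < cutWeight e i := by
  unfold cutWeight; positivity

/-- Across a cut `|i - j|` is the sum of the two distances plus one, and `i ⊕ j ≥ |i - j|`. -/
theorem xorKernel_le_of_cut {e i j : ℕ} (h : ¬(i < e ↔ j < e)) :
    xorKernel i j ≤ ((cutDist e i + cutDist e j + 1 : ℕ) : ℝ)⁻¹ := by
  refine inv_anti₀ (by positivity) (Nat.cast_le.2 ?_)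
  have h1 := le_add_xor i j
  have h2 := le_add_xor j i
  rw [Nat.xor_comm j i] at h2
  unfold cutDist
  split_ifs <;> omega

theorem sum_xorKernel_cut_le {m : ℕ} (e i : ℕ) :
    ∑ j : Fin m, (if (i < e ↔ (j : ℕ) < e) then 0 else xorKernel i j) * cutWeight e j ≤
      8 * cutWeight e i := by
  let S : Finset (Fin m) := {j | ¬(i < e ↔ (j : ℕ) < e)}
  calc _ = ∑ j ∈ S, xorKernel i j * cutWeight e j := by
        rw [Finset.sum_filter]
        refine Finset.sum_congr rfl fun j _ => ?_
        split_ifs <;> simp_all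
    _ ≤ ∑ j ∈ S, ((cutDist e i + cutDist e j + 1 : ℕ) : ℝ)⁻¹ * (√(cutDist e j + 1 : ℕ))⁻¹ :=
        Finset.sum_le_sum fun j hj => mul_le_mul_of_nonneg_right
          (xorKernel_le_of_cut (Finset.mem_filter.1 hj).2) (cutWeight_pos _ _).le
    _ = ∑ r ∈ S.image fun j : Fin m => cutDist e j,
        ((cutDist e i + r + 1 : ℕ) : ℝ)⁻¹ * (√(r + 1 : ℕ))⁻¹ := by
        -- All `j` in `S` lie on the side of the cut opposite to `i`, where `cutDist e` is
        -- injective.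
        rw [Finset.sum_image]
        intro j hj j' hj' h
        have hj := (Finset.mem_filter.1 hj).2
        have hj' := (Finset.mem_filter.1 hj').2
        simp only [cutDist] at h
        ext
        split_ifs at h <;> omega
    _ ≤ _ := sum_inv_mul_inv_sqrt_le _ _

/-! ### The composed adversary matrix. -/

/-- The hidden data: the number of a segment of a staircase, and the offsets of all segments. -/
abbrev Hidden (m : ℕ) : Type := Fin m × (Fin m → Fin m)

/-- The factor of the adversary matrix for the offset number `l`. -/
noncomputable def offsetFactor {m : ℕ} (j j' l s s' : Fin m) : ℝ :=
  if j < l ↔ j' < l then (if s = s' then 1 else 0) else xorKernel s s' / rowSum m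

/-- The composition of the adversary matrix of ordered search with itself. -/
noncomputable def adversary {m : ℕ} (x y : Hidden m) : ℝ :=
  xorKernel x.1 y.1 * ∏ l, offsetFactor x.1 y.1 l (x.2 l) (y.2 l)

theorem rowSum_nonneg (m : ℕ) : 0 ≤ rowSum m := Finset.sum_nonneg fun _ _ => by positivity

theorem offsetFactor_nonneg {m : ℕ} (j j' l s s' : Fin m) : 0 ≤ offsetFactor j j' l s s' := by
  unfold offsetFactor
  have := div_nonneg (xorKernel_nonneg s s') (rowSum_nonneg m)
  split_ifs <;> simp [this]

theorem offsetFactor_comm {m : ℕ} (j j' l s s' : Fin m) :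
    offsetFactor j j' l s s' = offsetFactor j' j l s' s := by
  simp only [offsetFactor, iff_comm (a := j < l), eq_comm (a := s), xorKernel_comm s]

theorem adversary_nonneg {m : ℕ} (x y : Hidden m) : 0 ≤ adversary x y :=
  mul_nonneg (xorKernel_nonneg _ _) (Finset.prod_nonneg fun _ _ => offsetFactor_nonneg _ _ _ _ _)

theorem adversary_comm {m : ℕ} (x y : Hidden m) : adversary x y = adversary y x := by
  simp only [adversary, xorKernel_comm x.1, offsetFactor_comm x.1]

theorem sum_offsetFactor {k : ℕ} (hk : 0 < rowSum (2 ^ k)) (j j' l s : Fin (2 ^ k)) :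
    ∑ t, offsetFactor j j' l s t = 1 := by
  unfold offsetFactor
  split_ifs
  · simp
  · rw [← Finset.sum_div, sum_xorKernel, div_self hk.ne']

theorem sum_adversary {k : ℕ} (hk : 0 < rowSum (2 ^ k)) (x : Hidden (2 ^ k)) :
    ∑ y, adversary x y = rowSum (2 ^ k) := by
  simp only [adversary]
  rw [Fintype.sum_prod_type]
  simp only [← Finset.mul_sum]
  simp only [← Fintype.prod_sum, sum_offsetFactor hk, Finset.prod_const_one, mul_one,
    sum_xorKernel]

/-- The adversary matrix restricted to pairs for which both the segment number and the offset
number `l` are separated by a cut. -/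
noncomputable def cutAdversary {m : ℕ} (l : Fin m) (e : ℕ) (x y : Hidden m) : ℝ :=
  if (x.1 < l ↔ y.1 < l) ∨ ((x.2 l : ℕ) < e ↔ (y.2 l : ℕ) < e) then 0 else adversary x y

theorem cutAdversary_nonneg {m : ℕ} (l : Fin m) (e : ℕ) (x y : Hidden m) :
    0 ≤ cutAdversary l e x y := by
  unfold cutAdversary
  split_ifs
  · rfl
  · exact adversary_nonneg x y

/-- The sum factors over the offsets. Every factor except number `l` sums to 1, and that one is the
normalised kernel restricted to a cut. -/
theorem sum_prod_offsetFactor_cut_le {k : ℕ} (hk : 0 < rowSum (2 ^ k)) (l : Fin (2 ^ k)) (e : ℕ)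
    (j j' : Fin (2 ^ k)) (hj : ¬(j < l ↔ j' < l)) (s : Fin (2 ^ k) → Fin (2 ^ k)) :
    ∑ t : Fin (2 ^ k) → Fin (2 ^ k), (∏ i, offsetFactor j j' i (s i) (t i)) *
      (if ((s l : ℕ) < e ↔ (t l : ℕ) < e) then 0 else cutWeight e (t l)) ≤
    8 / rowSum (2 ^ k) * cutWeight e (s l) := by
  let g (i t : Fin (2 ^ k)) : ℝ := offsetFactor j j' i (s i) t *
    if i = l then (if ((s l : ℕ) < e ↔ (t : ℕ) < e) then 0 else cutWeight e t) else 1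
  calc _ = ∑ t : Fin (2 ^ k) → Fin (2 ^ k), ∏ i, g i (t i) := by
        refine Finset.sum_congr rfl fun t _ => ?_
        simp only [g, Finset.prod_mul_distrib, Finset.prod_ite_eq', Finset.mem_univ, if_true]
    _ = ∏ i, ∑ t, g i t := (Fintype.prod_sum g).symm
    _ = ∑ t, g l t := by
        refine Finset.prod_eq_single l (fun i _ hi => ?_) (by simp)
        simp only [g, if_neg hi, mul_one, sum_offsetFactor hk]
    _ = (∑ t : Fin (2 ^ k), (if ((s l : ℕ) < e ↔ (t : ℕ) < e) then 0 else xorKernel (s l) t) *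
        cutWeight e t) / rowSum (2 ^ k) := by
        rw [Finset.sum_div]
        refine Finset.sum_congr rfl fun t _ => ?_
        simp only [g, offsetFactor, if_neg hj, if_true]
        split_ifs <;> ring
    _ ≤ 8 * cutWeight e (s l) / rowSum (2 ^ k) :=
        div_le_div_of_nonneg_right (sum_xorKernel_cut_le e (s l)) hk.le
    _ = _ := by ring

/-- Schur test with product weights: the cut in the segment number and the cut in the offset each
give 8, and the normalisation of the offset kernel gives `1 / rowSum`. -/
theorem cutAdversary_quadratic_le {k : ℕ} (hk : 0 < rowSum (2 ^ k)) (l : Fin (2 ^ k)) (e : ℕ)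
    (u : Hidden (2 ^ k) → ℝ) :
    ∑ x, ∑ y, cutAdversary l e x y * (u x * u y) ≤ 64 / rowSum (2 ^ k) * ∑ x, u x ^ 2 := by
  refine schur_test _ (fun x => cutWeight l x.1 * cutWeight e (x.2 l)) _
    (cutAdversary_nonneg l e) (fun x y => ?_)
    (fun x => mul_pos (cutWeight_pos _ _) (cutWeight_pos _ _)) (fun x => ?_) u
  · simp only [cutAdversary, adversary_comm x, iff_comm (a := x.1 < l),
      iff_comm (a := (x.2 l : ℕ) < e)]
  · rw [Fintype.sum_prod_type]
    calc _ = ∑ j' : Fin (2 ^ k), (if x.1 < l ↔ j' < l then 0 else xorKernel x.1 j') *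
          cutWeight l j' * ∑ t : Fin (2 ^ k) → Fin (2 ^ k),
          (∏ i, offsetFactor x.1 j' i (x.2 i) (t i)) *
          (if ((x.2 l : ℕ) < e ↔ (t l : ℕ) < e) then 0 else cutWeight e (t l)) := by
          refine Finset.sum_congr rfl fun j' _ => ?_
          rw [Finset.mul_sum]
          refine Finset.sum_congr rfl fun t _ => ?_
          by_cases h1 : x.1 < l ↔ j' < l
          · simp [cutAdversary, h1]
          · by_cases h2 : (x.2 l : ℕ) < e ↔ (t l : ℕ) < e
            · simp [cutAdversary, h2]
            · simp only [cutAdversary, h1, h2, or_self, if_false, adversary]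
              ring
      _ ≤ ∑ j' : Fin (2 ^ k), (if x.1 < l ↔ j' < l then 0 else xorKernel x.1 j') *
          cutWeight l j' * (8 / rowSum (2 ^ k) * cutWeight e (x.2 l)) := by
          refine Finset.sum_le_sum fun j' _ => ?_
          by_cases h : x.1 < l ↔ j' < l
          · simp [h]
          · refine mul_le_mul_of_nonneg_left (sum_prod_offsetFactor_cut_le hk l e _ _ h _) ?_
            rw [if_neg h]
            exact mul_nonneg (xorKernel_nonneg _ _) (cutWeight_pos _ _).le
      _ ≤ 8 * cutWeight l x.1 * (8 / rowSum (2 ^ k) * cutWeight e (x.2 l)) := by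
          rw [← Finset.sum_mul]
          refine mul_le_mul_of_nonneg_right ?_ ?_
          · exact sum_xorKernel_cut_le l x.1
          · exact mul_nonneg (div_nonneg (by norm_num) hk.le) (cutWeight_pos _ _).le
      _ = _ := by ring

/-! ### The staircase functions. -/

section Staircase

/-- The abscissa of the vertical segment number `2 a + 1` of the staircase with offsets `σ`. -/
def vert (m : ℕ) (σ : ℕ → ℕ) (a : ℕ) : ℕ := a * m + σ (2 * a + 1)

/-- The ordinate of the horizontal segment number `2 b` of the staircase with offsets `σ`. -/
def horiz (m : ℕ) (σ : ℕ → ℕ) (b : ℕ) : ℕ := b * m + σ (2 * b)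

/-- The abscissa towards which points with ordinate `y` move. On the staircase, motion is forward on
the segments up to number `j`, and backward on later ones. -/
def abscissaTarget (m j : ℕ) (σ : ℕ → ℕ) (y : ℕ) : ℕ :=
  -- For `y / m = 0` the truncated subtraction makes both branches aim at `vert m σ 0`.
  if y < horiz m σ (y / m) ∨ (horiz m σ (y / m) = y ∧ j < 2 * (y / m)) then
    vert m σ (y / m - 1) else vert m σ (y / m)

/-- The ordinate towards which points with abscissa `x` move. -/
def ordinateTarget (m j : ℕ) (σ : ℕ → ℕ) (x : ℕ) : ℕ :=
  if x < vert m σ (x / m) ∨ (vert m σ (x / m) = x ∧ j < 2 * (x / m) + 1) then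
    horiz m σ (x / m) else horiz m σ (x / m + 1)

/-- Move `x` by at most one towards `c`. -/
def stepTo (x c : ℕ) : ℕ := if x < c then x + 1 else if c < x then x - 1 else x

theorem stepTo_mono {x x' c c' : ℕ} (hx : x ≤ x') (hc : c ≤ c') : stepTo x c ≤ stepTo x' c' := by
  unfold stepTo
  split_ifs <;> omega

theorem stepTo_lt {x c n : ℕ} (hx : x < n) (hc : c < n) : stepTo x c < n := by
  unfold stepTo
  split_ifs <;> omega

theorem stepTo_eq_self_iff {x c : ℕ} : stepTo x c = x ↔ x = c := by
  unfold stepTo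
  split_ifs <;> omega

/-- Steps of length at most one let a query reveal only how `x` compares with the target, not the
target itself. -/
theorem stepTo_min_congr {x c c' N : ℕ} (hx : x ≤ N) (h₁ : x < c ↔ x < c') (h₂ : c < x ↔ c' < x) :
    stepTo x (min c N) = stepTo x (min c' N) := by
  unfold stepTo
  split_ifs <;> omega

variable {m : ℕ}

theorem lt_mul_add_iff {x c s : ℕ} (hs : s < m) :
    x < c * m + s ↔ x / m < c ∨ (x / m = c ∧ x % m < s) := by
  have hm : 0 < m := by omega
  have hx := Nat.div_add_mod' x m
  have hr := Nat.mod_lt x hm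
  rcases lt_trichotomy (x / m) c with h | h | h
  · have := Nat.mul_le_mul_right m (Nat.succ_le_of_lt h)
    rw [Nat.succ_mul] at this
    omega
  · subst h; omega
  · have := Nat.mul_le_mul_right m (Nat.succ_le_of_lt h)
    rw [Nat.succ_mul] at this
    omega

theorem mul_add_eq_iff {x c s : ℕ} (hs : s < m) :
    c * m + s = x ↔ x / m = c ∧ x % m = s := by
  have hm : 0 < m := by omega
  constructor
  · rintro rfl
    rw [Nat.add_comm, Nat.add_mul_div_right _ _ hm, Nat.add_mul_mod_self_right,
      Nat.div_eq_of_lt hs, Nat.mod_eq_of_lt hs]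
    simp
  · rintro ⟨rfl, rfl⟩
    exact Nat.div_add_mod' x m

theorem mul_add_lt_iff {x c s : ℕ} (hs : s < m) :
    c * m + s < x ↔ c < x / m ∨ (x / m = c ∧ s < x % m) := by
  have h₁ := lt_mul_add_iff (x := x) (c := c) hs
  have h₂ := mul_add_eq_iff (x := x) (c := c) hs
  omega

variable {σ σ' : ℕ → ℕ}

theorem vert_mono (hσ : ∀ l, σ l < m) : Monotone (vert m σ) :=
  monotone_nat_of_le_succ fun a => by
    have := hσ (2 * a + 1)
    rw [vert, vert, Nat.succ_mul a m]
    omega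

theorem horiz_mono (hσ : ∀ l, σ l < m) : Monotone (horiz m σ) :=
  monotone_nat_of_le_succ fun a => by
    have := hσ (2 * a)
    rw [horiz, horiz, Nat.succ_mul a m]
    omega

theorem abscissaTarget_mono (hσ : ∀ l, σ l < m) (j : ℕ) : Monotone (abscissaTarget m j σ) := by
  intro y y' h
  have hd := Nat.div_le_div_right (c := m) h
  unfold abscissaTarget
  generalize y / m = b at *
  generalize y' / m = b' at *
  rcases hd.eq_or_lt with rfl | hd
  · split_ifs
    · rfl
    · exact vert_mono hσ (by omega)
    · omega
    · rfl
  · split_ifs <;> exact vert_mono hσ (by omega)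

theorem ordinateTarget_mono (hσ : ∀ l, σ l < m) (j : ℕ) : Monotone (ordinateTarget m j σ) := by
  intro y y' h
  have hd := Nat.div_le_div_right (c := m) h
  unfold ordinateTarget
  generalize y / m = b at *
  generalize y' / m = b' at *
  rcases hd.eq_or_lt with rfl | hd
  · split_ifs
    · rfl
    · exact horiz_mono hσ (by omega)
    · omega
    · rfl
  · split_ifs <;> exact horiz_mono hσ (by omega)

/-- The comparison of the offset number `l` with `e` does not distinguish `(j, σ)` from
`(j', σ')`. -/
def Agree (j j' : ℕ) (σ σ' : ℕ → ℕ) (l e : ℕ) : Prop :=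
  ((j < l ↔ j' < l) ∧ σ l = σ' l) ∨ (σ l < e ∧ σ' l < e) ∨ (e < σ l ∧ e < σ' l)

/-- Comparing `x` with `vert m σ c` involves an offset only if `c = x / m`; otherwise the block
numbers decide. The direction on segment `2 * (y / m)` matters only if its offset equals `y % m`. -/
theorem stepTo_abscissaTarget_congr (hσ : ∀ l, σ l < m) (hσ' : ∀ l, σ' l < m) {j j' x y N : ℕ}
    (hN : x ≤ N) (hx : Agree j j' σ σ' (2 * (x / m) + 1) (x % m))
    (hy : Agree j j' σ σ' (2 * (y / m)) (y % m)) :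
    stepTo x (min (abscissaTarget m j σ y) N) = stepTo x (min (abscissaTarget m j' σ' y) N) := by
  have target (c : ℕ) : stepTo x (min (vert m σ c) N) = stepTo x (min (vert m σ' c) N) := by
    apply stepTo_min_congr hN
    · rw [vert, vert, lt_mul_add_iff (hσ _), lt_mul_add_iff (hσ' _)]
      by_cases h : x / m = c
      · subst h; unfold Agree at hx; omega
      · simp [h]
    · rw [vert, vert, mul_add_lt_iff (hσ _), mul_add_lt_iff (hσ' _)]
      by_cases h : x / m = c
      · subst h; unfold Agree at hx; omega
      · simp [h]
  have branch : (y < horiz m σ (y / m) ∨ (horiz m σ (y / m) = y ∧ j < 2 * (y / m))) ↔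
      (y < horiz m σ' (y / m) ∨ (horiz m σ' (y / m) = y ∧ j' < 2 * (y / m))) := by
    rw [horiz, horiz, lt_mul_add_iff (hσ _), lt_mul_add_iff (hσ' _), mul_add_eq_iff (hσ _),
      mul_add_eq_iff (hσ' _)]
    unfold Agree at hy
    omega
  unfold abscissaTarget
  simp only [branch]
  split_ifs <;> exact target _

theorem stepTo_ordinateTarget_congr (hσ : ∀ l, σ l < m) (hσ' : ∀ l, σ' l < m) {j j' x y N : ℕ}
    (hN : y ≤ N) (hx : Agree j j' σ σ' (2 * (x / m) + 1) (x % m))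
    (hy : Agree j j' σ σ' (2 * (y / m)) (y % m)) :
    stepTo y (min (ordinateTarget m j σ x) N) = stepTo y (min (ordinateTarget m j' σ' x) N) := by
  have target (c : ℕ) : stepTo y (min (horiz m σ c) N) = stepTo y (min (horiz m σ' c) N) := by
    apply stepTo_min_congr hN
    · rw [horiz, horiz, lt_mul_add_iff (hσ _), lt_mul_add_iff (hσ' _)]
      by_cases h : y / m = c
      · subst h; unfold Agree at hy; omega
      · simp [h]
    · rw [horiz, horiz, mul_add_lt_iff (hσ _), mul_add_lt_iff (hσ' _)]
      by_cases h : y / m = c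
      · subst h; unfold Agree at hy; omega
      · simp [h]
  have branch : (x < vert m σ (x / m) ∨ (vert m σ (x / m) = x ∧ j < 2 * (x / m) + 1)) ↔
      (x < vert m σ' (x / m) ∨ (vert m σ' (x / m) = x ∧ j' < 2 * (x / m) + 1)) := by
    rw [vert, vert, lt_mul_add_iff (hσ _), lt_mul_add_iff (hσ' _), mul_add_eq_iff (hσ _),
      mul_add_eq_iff (hσ' _)]
    unfold Agree at hx
    omega
  unfold ordinateTarget
  simp only [branch]
  split_ifs <;> exact target _

/-- The motion has its fixed points only where the segments number `j` and `j + 1` meet. -/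
theorem div_add_div_eq_of_fixed (hσ : ∀ l, σ l < m) {j x y N : ℕ} (hm : 2 ≤ m) (hj : j < m)
    (hN : m * m ≤ N + 1) (hx : x = min (abscissaTarget m j σ y) N)
    (hy : y = min (ordinateTarget m j σ x) N) : x / m + y / m = j := by
  have hNm : m - 1 ≤ N / m := by
    rw [Nat.le_div_iff_mul_le (by omega), Nat.sub_mul]
    omega
  obtain ⟨c, hc, hxc⟩ : ∃ c, ((y % m < σ (2 * (y / m)) ∨
      (y % m = σ (2 * (y / m)) ∧ j < 2 * (y / m))) ∧ c = y / m - 1 ∨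
      ¬(y % m < σ (2 * (y / m)) ∨ (y % m = σ (2 * (y / m)) ∧ j < 2 * (y / m))) ∧ c = y / m) ∧
      x = min (vert m σ c) N := by
    unfold abscissaTarget at hx
    simp only [horiz, lt_mul_add_iff (hσ _), mul_add_eq_iff (hσ _), lt_irrefl, false_or,
      true_and] at hx
    split_ifs at hx with h
    · exact ⟨_, Or.inl ⟨h, rfl⟩, hx⟩
    · exact ⟨_, Or.inr ⟨h, rfl⟩, hx⟩
  obtain ⟨d, hd, hyd⟩ : ∃ d, ((x % m < σ (2 * (x / m) + 1) ∨
      (x % m = σ (2 * (x / m) + 1) ∧ j < 2 * (x / m) + 1)) ∧ d = x / m ∨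
      ¬(x % m < σ (2 * (x / m) + 1) ∨ (x % m = σ (2 * (x / m) + 1) ∧ j < 2 * (x / m) + 1)) ∧
        d = x / m + 1) ∧ y = min (horiz m σ d) N := by
    unfold ordinateTarget at hy
    simp only [vert, lt_mul_add_iff (hσ _), mul_add_eq_iff (hσ _), lt_irrefl, false_or,
      true_and] at hy
    split_ifs at hy with h
    · exact ⟨_, Or.inl ⟨h, rfl⟩, hy⟩
    · exact ⟨_, Or.inr ⟨h, rfl⟩, hy⟩
  -- Either the target is attained or it was cut off at `N`. The second case occurs only in blocks
  -- from `m - 1` on, whose segments have numbers at least `2 (m - 1) ≥ m > j`; motion there is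
  -- backward, which excludes it.
  have hA : (x / m = c ∧ x % m = σ (2 * c + 1)) ∨
      (m - 1 ≤ x / m ∧ (x / m < c ∨ (x / m = c ∧ x % m < σ (2 * c + 1)))) := by
    rw [← mul_add_eq_iff (hσ _), ← lt_mul_add_iff (hσ _)]
    change vert m σ c = x ∨ _ ∧ x < vert m σ c
    rcases le_or_gt (vert m σ c) N with h | h
    · left; omega
    · have : x = N := by omega
      right; exact ⟨this ▸ hNm, by omega⟩
  have hB : (y / m = d ∧ y % m = σ (2 * d)) ∨
      (m - 1 ≤ y / m ∧ (y / m < d ∨ (y / m = d ∧ y % m < σ (2 * d)))) := by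
    rw [← mul_add_eq_iff (hσ _), ← lt_mul_add_iff (hσ _)]
    change horiz m σ d = y ∨ _ ∧ y < horiz m σ d
    rcases le_or_gt (horiz m σ d) N with h | h
    · left; omega
    · have : y = N := by omega
      right; exact ⟨this ▸ hNm, by omega⟩
  clear hxc hyd hx hy hN hNm
  generalize x / m = a at *
  generalize y / m = b at *
  generalize x % m = e at *
  generalize y % m = f at *
  -- For `omega` the values of `σ` are unrelated atoms, so congruence has to be supplied.
  have hcong₁ : c = a → σ (2 * c + 1) = σ (2 * a + 1) := fun h => by rw [h]
  have hcong₂ : d = b → σ (2 * d) = σ (2 * b) := fun h => by rw [h]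
  omega

/-- The monotone function on `[n]²` with a fixed point hidden on a staircase. -/
def staircaseMap (m n j : ℕ) (σ : ℕ → ℕ) (v : QuantumQuery.Grid n 2) : QuantumQuery.Grid n 2 :=
  ![⟨stepTo (v 0) (min (abscissaTarget m j σ (v 1)) (n - 1)),
      stepTo_lt (v 0).2 (by have := (v 0).2; omega)⟩,
    ⟨stepTo (v 1) (min (ordinateTarget m j σ (v 0)) (n - 1)),
      stepTo_lt (v 1).2 (by have := (v 1).2; omega)⟩]

theorem staircaseMap_mono (hσ : ∀ l, σ l < m) (n j : ℕ) : Monotone (staircaseMap m n j σ) := by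
  intro v v' h i
  fin_cases i
  · exact stepTo_mono (h 0) (min_le_min_right _ (abscissaTarget_mono hσ j (h 1)))
  · exact stepTo_mono (h 1) (min_le_min_right _ (ordinateTarget_mono hσ j (h 0)))

theorem staircaseMap_congr (hσ : ∀ l, σ l < m) (hσ' : ∀ l, σ' l < m) {n j j' : ℕ}
    {v : QuantumQuery.Grid n 2}
    (hx : Agree j j' σ σ' (2 * ((v 0 : ℕ) / m) + 1) ((v 0 : ℕ) % m))
    (hy : Agree j j' σ σ' (2 * ((v 1 : ℕ) / m)) ((v 1 : ℕ) % m)) :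
    staircaseMap m n j σ v = staircaseMap m n j' σ' v := by
  ext i
  fin_cases i
  · exact stepTo_abscissaTarget_congr hσ hσ' (by have := (v 0).2; omega) hx hy
  · exact stepTo_ordinateTarget_congr hσ hσ' (by have := (v 1).2; omega) hx hy

theorem div_add_div_eq_of_staircaseMap (hσ : ∀ l, σ l < m) {n j : ℕ} (hm : 2 ≤ m) (hj : j < m)
    (hn : m * m ≤ n) {v : QuantumQuery.Grid n 2} (h : staircaseMap m n j σ v = v) :
    (v 0 : ℕ) / m + (v 1 : ℕ) / m = j :=
  div_add_div_eq_of_fixed hσ (N := n - 1) hm hj (by omega)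
    (stepTo_eq_self_iff.1 (congrArg Fin.val (congrFun h 0)))
    (stepTo_eq_self_iff.1 (congrArg Fin.val (congrFun h 1)))

end Staircase

/-! ### The adversary bound applied to the staircase functions. -/

/-- The offsets, continued by zero. -/
def extend {m : ℕ} (s : Fin m → Fin m) (l : ℕ) : ℕ := if h : l < m then s ⟨l, h⟩ else 0

theorem extend_lt {m : ℕ} (hm : 0 < m) (s : Fin m → Fin m) (l : ℕ) : extend s l < m := by
  unfold extend
  split_ifs with h
  · exact (s _).2
  · exact hm

theorem ne_of_adversary_ne_zero {m : ℕ} {x y : Hidden m} (h : adversary x y ≠ 0) : x.1 ≠ y.1 := by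
  intro h'
  simp [adversary, h', xorKernel_self] at h

/-- Each factor is either the identity matrix or a kernel vanishing on the diagonal, so an offset
changes exactly when the direction on its segment does. -/
theorem offset_eq_iff_of_adversary_ne_zero {m : ℕ} {x y : Hidden m} (h : adversary x y ≠ 0)
    (l : Fin m) : (x.1 < l ↔ y.1 < l) ↔ x.2 l = y.2 l := by
  have h := Finset.prod_ne_zero_iff.1 (right_ne_zero_of_mul h) l (Finset.mem_univ l)
  unfold offsetFactor at h
  split_ifs at h with h₁ h₂
  · exact iff_of_true h₁ h₂
  · exact absurd rfl h
  · refine iff_of_false h₁ fun h₂ => h ?_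
    rw [h₂, xorKernel_self, zero_div]

/-- The part of the adversary matrix which comparing the offset number `l` with `e` detects. -/
noncomputable def detected {m : ℕ} (l e : ℕ) (x y : Hidden m) : ℝ :=
  if h : l < m then cutAdversary ⟨l, h⟩ e x y + cutAdversary ⟨l, h⟩ (e + 1) x y else 0

theorem detected_nonneg {m : ℕ} (l e : ℕ) (x y : Hidden m) : 0 ≤ detected l e x y := by
  unfold detected
  split_ifs
  · exact add_nonneg (cutAdversary_nonneg _ _ _ _) (cutAdversary_nonneg _ _ _ _)
  · rfl

theorem adversary_le_detected {m : ℕ} {l e : ℕ} {x y : Hidden m} (h₀ : adversary x y ≠ 0)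
    (h : ¬ Agree x.1 y.1 (extend x.2) (extend y.2) l e) : adversary x y ≤ detected l e x y := by
  unfold Agree extend at h
  by_cases hl : l < m
  · have h₁ := offset_eq_iff_of_adversary_ne_zero h₀ ⟨l, hl⟩
    simp only [hl, dif_pos, Fin.lt_def, Fin.ext_iff] at h h₁
    -- Two different offsets not strictly on the same side of `e` are separated by the cut below `e`
    -- or by the one above it.
    have key : ¬((x.1 < (⟨l, hl⟩ : Fin m) ↔ y.1 < (⟨l, hl⟩ : Fin m)) ∨
        ((x.2 ⟨l, hl⟩ : ℕ) < e ↔ (y.2 ⟨l, hl⟩ : ℕ) < e)) ∨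
        ¬((x.1 < (⟨l, hl⟩ : Fin m) ↔ y.1 < (⟨l, hl⟩ : Fin m)) ∨
        ((x.2 ⟨l, hl⟩ : ℕ) < e + 1 ↔ (y.2 ⟨l, hl⟩ : ℕ) < e + 1)) := by
      simp only [Fin.lt_def]
      omega
    have n₁ := cutAdversary_nonneg ⟨l, hl⟩ e x y
    have n₂ := cutAdversary_nonneg ⟨l, hl⟩ (e + 1) x y
    rw [detected, dif_pos hl]
    rcases key with key | key
    · have : cutAdversary ⟨l, hl⟩ e x y = adversary x y := if_neg key
      linarith
    · have : cutAdversary ⟨l, hl⟩ (e + 1) x y = adversary x y := if_neg key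
      linarith
  -- Beyond segment `m - 1` both offsets are 0 and both directions are backward, so the data agree.
  · have := x.1.2
    have := y.1.2
    rw [dif_neg hl, dif_neg hl] at h
    omega

theorem detected_quadratic_le {k : ℕ} (hk : 0 < rowSum (2 ^ k)) (l e : ℕ)
    (u : Hidden (2 ^ k) → ℝ) :
    ∑ x, ∑ y, detected l e x y * (u x * u y) ≤ 128 / rowSum (2 ^ k) * ∑ x, u x ^ 2 := by
  by_cases h : l < 2 ^ k
  · have h₁ := cutAdversary_quadratic_le hk ⟨l, h⟩ e u
    have h₂ := cutAdversary_quadratic_le hk ⟨l, h⟩ (e + 1) u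
    simp only [detected, dif_pos h, add_mul, Finset.sum_add_distrib]
    calc _ ≤ _ := add_le_add h₁ h₂
      _ = _ := by ring
  · simp only [detected, dif_neg h, zero_mul, Finset.sum_const_zero]
    positivity

/-- The monotone function which belongs to the hidden data. -/
def hiddenMap {m : ℕ} (n : ℕ) (x : Hidden m) : QuantumQuery.Grid n 2 → QuantumQuery.Grid n 2 :=
  staircaseMap m n x.1 (extend x.2)

theorem distinguished_le {m n : ℕ} (x y : Hidden m) (q : QuantumQuery.Grid n 2) :
    (if hiddenMap n x q = hiddenMap n y q then 0 else adversary x y) ≤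
      detected (2 * ((q 0 : ℕ) / m) + 1) ((q 0 : ℕ) % m) x y +
      detected (2 * ((q 1 : ℕ) / m)) ((q 1 : ℕ) % m) x y := by
  have n₁ := detected_nonneg (2 * ((q 0 : ℕ) / m) + 1) ((q 0 : ℕ) % m) x y
  have n₂ := detected_nonneg (2 * ((q 1 : ℕ) / m)) ((q 1 : ℕ) % m) x y
  have hm : 0 < m := x.1.pos
  split_ifs with h
  · positivity
  · by_cases h₀ : adversary x y = 0
    · rw [h₀]; positivity
    · by_cases h₁ : Agree x.1 y.1 (extend x.2) (extend y.2) (2 * ((q 0 : ℕ) / m) + 1)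
          ((q 0 : ℕ) % m)
      · have h₂ : ¬ Agree x.1 y.1 (extend x.2) (extend y.2) (2 * ((q 1 : ℕ) / m))
            ((q 1 : ℕ) % m) :=
          fun h₂ => h (staircaseMap_congr (extend_lt hm _) (extend_lt hm _) h₁ h₂)
        linarith [adversary_le_detected h₀ h₂]
      · linarith [adversary_le_detected h₀ h₁]

theorem distinguished_quadratic_le {k n : ℕ} (hk : 0 < rowSum (2 ^ k))
    (q : QuantumQuery.Grid n 2) (u : Hidden (2 ^ k) → ℝ) :
    ∑ x, ∑ y, (if hiddenMap n x q = hiddenMap n y q then 0 else adversary x y) * (u x * u y) ≤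
      256 / rowSum (2 ^ k) * ∑ x, u x ^ 2 := by
  -- The entrywise bound passes to the quadratic form only for nonnegative vectors, hence `|u x|`.
  -- The constant is `256 = 64 · 2 · 2`: two cuts for each of two coordinates.
  have h₁ := detected_quadratic_le hk (2 * ((q 0 : ℕ) / 2 ^ k) + 1) ((q 0 : ℕ) % 2 ^ k)
    fun x => |u x|
  have h₂ := detected_quadratic_le hk (2 * ((q 1 : ℕ) / 2 ^ k)) ((q 1 : ℕ) % 2 ^ k)
    fun x => |u x|
  simp only [sq_abs] at h₁ h₂
  calc _ ≤ ∑ x, ∑ y, (detected (2 * ((q 0 : ℕ) / 2 ^ k) + 1) ((q 0 : ℕ) % 2 ^ k) x y +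
        detected (2 * ((q 1 : ℕ) / 2 ^ k)) ((q 1 : ℕ) % 2 ^ k) x y) * (|u x| * |u y|) := by
        refine Finset.sum_le_sum fun x _ => Finset.sum_le_sum fun y _ => ?_
        refine le_trans (mul_le_mul_of_nonneg_left
          ((le_abs_self _).trans_eq (abs_mul (u x) (u y))) ?_)
          (mul_le_mul_of_nonneg_right (distinguished_le x y q) (by positivity))
        split_ifs
        · rfl
        · exact adversary_nonneg x y
    _ ≤ _ := by
        simp only [add_mul, Finset.sum_add_distrib]
        exact (add_le_add h₁ h₂).trans_eq (by ring)

theorem hiddenMap_mono {m : ℕ} (n : ℕ) (x : Hidden m) : Monotone (hiddenMap n x) :=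
  staircaseMap_mono (extend_lt x.1.pos _) n _

theorem eq_of_hiddenMap_fixed {m n : ℕ} (hm : 2 ≤ m) (hn : m * m ≤ n) {x y : Hidden m}
    {v : QuantumQuery.Grid n 2} (hx : hiddenMap n x v = v) (hy : hiddenMap n y v = v) :
    x.1 = y.1 := by
  have h₁ := div_add_div_eq_of_staircaseMap (extend_lt x.1.pos _) hm x.1.2 hn hx
  have h₂ := div_add_div_eq_of_staircaseMap (extend_lt y.1.pos _) hm y.1.2 hn hy
  exact Fin.ext (h₁.symm.trans h₂)

theorem rowSum_sq_le_queries {k n ℓ : ℕ} (hk : 1 ≤ k) (hn : 2 ^ k * 2 ^ k ≤ n)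
    {enc : QuantumQuery.Grid n 2 ↪ QuantumQuery.BitString ℓ}
    {A : QuantumQuery.Algorithm (QuantumQuery.Grid n 2) (QuantumQuery.Grid n 2) ℓ}
    (hA : A.Solves enc (QuantumQuery.tarski n 2)) :
    (k * Real.log 2) ^ 2 ≤ 9216 * A.queries := by
  have hlog : k * Real.log 2 ≤ rowSum (2 ^ k) := by
    simpa using log_le_rowSum (m := 2 ^ k) (by positivity)
  have hlog0 : 0 < k * Real.log 2 :=
    mul_pos (by exact_mod_cast hk) (Real.log_pos (by norm_num))
  have hr : 0 < rowSum (2 ^ k) := hlog0.trans_le hlog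
  have hm : 2 ≤ 2 ^ k := by simpa using Nat.pow_le_pow_right (n := 2) (by norm_num) hk
  have key := hA.adversary_bound (X := Hidden (2 ^ k)) (hiddenMap n)
    (hiddenMap_mono n) adversary (rowSum (2 ^ k))
    (256 / rowSum (2 ^ k)) adversary_nonneg (sum_adversary hr)
    (fun x y h o hx hy => ne_of_adversary_ne_zero h (eq_of_hiddenMap_fixed hm hn hx hy))
    (fun q u => by convert distinguished_quadratic_le hr q u)
  calc (k * Real.log 2) ^ 2 ≤ rowSum (2 ^ k) ^ 2 := pow_le_pow_left₀ hlog0.le hlog 2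
    _ ≤ rowSum (2 ^ k) * (36 * (256 / rowSum (2 ^ k)) * A.queries) := by
        rw [sq]; exact mul_le_mul_of_nonneg_left key hr.le
    _ = _ := by field_simp; ring

theorem log_sq_le_queries {n ℓ : ℕ} (hn : 4 ≤ n)
    {enc : QuantumQuery.Grid n 2 ↪ QuantumQuery.BitString ℓ}
    {A : QuantumQuery.Algorithm (QuantumQuery.Grid n 2) (QuantumQuery.Grid n 2) ℓ}
    (hA : A.Solves enc (QuantumQuery.tarski n 2)) :
    1 / 147456 * Real.log n ^ 2 ≤ A.queries := by
  have hL : 2 ≤ Nat.log 2 n := Nat.le_log_of_pow_le (by norm_num) (by simpa using hn)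
  -- The largest `k` with `4 ^ k ≤ n`. As `k ≥ 1`, also `Nat.log 2 n + 1 ≤ 2 k + 2 ≤ 4 k`; the
  -- factor 4, squared, gives `147456 = 16 · 9216`.
  obtain ⟨k, hk⟩ : ∃ k, k = Nat.log 2 n / 2 := ⟨_, rfl⟩
  have h₁ : 2 ^ k * 2 ^ k ≤ n := by
    rw [← pow_add]
    exact (Nat.pow_le_pow_right (by norm_num) (by omega)).trans
      (Nat.pow_log_le_self 2 (by omega))
  have h₂ : n ≤ 2 ^ (4 * k) :=
    (Nat.lt_pow_succ_log_self (by norm_num) n).le.trans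
      (Nat.pow_le_pow_right (by norm_num) (by omega))
  have h₃ : Real.log n ≤ 4 * (k * Real.log 2) := by
    have := Real.log_le_log (by positivity) (show (n : ℝ) ≤ 2 ^ (4 * k) by exact_mod_cast h₂)
    rw [Real.log_pow] at this
    push_cast at this
    linarith
  have h₄ := rowSum_sq_le_queries (by omega) h₁ hA
  have h₅ : Real.log n ^ 2 ≤ (4 * (k * Real.log 2)) ^ 2 :=
    pow_le_pow_left₀ (Real.log_natCast_nonneg n) h₃ 2
  linarith

end TarskiLowerBound

theorem theorem1 :
    ∃ c : ℝ, 0 < c ∧ ∀ᶠ n : ℕ in Filter.atTop,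
      ∀ (ℓ : ℕ) (enc : QuantumQuery.Grid n 2 ↪ QuantumQuery.BitString ℓ),
        ENNReal.ofReal (c * Real.log (n : ℝ) ^ 2) ≤
          (QuantumQuery.queryComplexity enc (QuantumQuery.tarski n 2) : ℝ≥0∞) := by
  refine ⟨1 / 147456, by norm_num, Filter.eventually_atTop.2 ⟨4, fun n hn ℓ enc => ?_⟩⟩
  have h : ((⌈1 / 147456 * Real.log (n : ℝ) ^ 2⌉₊ : ℕ) : ℕ∞) ≤
      QuantumQuery.queryComplexity enc (QuantumQuery.tarski n 2) :=
    le_iInf fun A => le_iInf fun hA =>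
      Nat.cast_le.2 (Nat.ceil_le.2 (TarskiLowerBound.log_sq_le_queries hn hA))
  calc ENNReal.ofReal (1 / 147456 * Real.log (n : ℝ) ^ 2)
      ≤ ((⌈1 / 147456 * Real.log (n : ℝ) ^ 2⌉₊ : ℕ) : ℝ≥0∞) := by
        rw [← ENNReal.ofReal_natCast]
        exact ENNReal.ofReal_le_ofReal (Nat.le_ceil _)
    _ ≤ _ := by simpa using ENat.toENNReal_le.2 h
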